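/- Let $k,n,c$ be integers with $1\le k<n$, $0\le c\le k-1$ and $2k-c\le n\le (3k+1)/2$. For a prime power $q$ and $0<j<m$, let $\mathcal G_q(j,m)$ be the set of $j$-dimensional subspaces of $\mathbb F_q^m$. A code in $\mathcal G_q(j,m)$ is a subset $\mathcal C\subseteq \mathcal G_q(j,m)$ with $|\mathcal C|\ge 2$; its minimum distance $d(\mathcal C)$ is the minimum of $d(U,V)=\dim U+\dim V-2\dim(U\cap V)$ over distinct $U,V\in\mathcal C$. It is equidistant if $d(U,V)=d(\mathcal C)$ for all distinct $U,V\in\mathcal C$, and, for $0\le i\le j-1$, an equidistant code is $i$-intersecting if $d(\mathcal C)=2(j-i)$. Let $e_q(j,m,i)$ be the largest cardinality of an $i$-intersecting equidistant code in $\mathcal G_q(j,m)$. A code $\mathcal S\subseteq\mathcal G_q(j,m)$ is a sunflower if there is a subspace $Z\subseteq\mathbb F_q^m$ with $U\cap V=Z$ for all distinct $U,V\in\mathcal S$. The orthogonal of a code $\mathcal S$ is $\mathcal S^\perp=\{U^\perp: U\in\mathcal S\}$, where $U^\perp$ is the orthogonal of $U$ with respect to the standard inner product of $\mathbb F_q^m$.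 Then there is a $q_0$, depending only on $k,n,c$, such that for every prime power $q\ge q_0$: $$e_q(k,n,c)=e_q(k-c,2k-c,0),$$ and every $c$-intersecting equidistant code $\mathcal C\subseteq\mathcal G_q(k,n)$ with $|\mathcal C|=e_q(k,n,c)$ is of the form $\mathcal C=\mathcal S^\perp$ for some sunflower $\mathcal S\subseteq\mathcal G_q(n-k,n)$. -/

import Mathlib

namespace SubspaceCode

/-- The set `𝒢_q(k, n)` of `k`-dimensional subspaces of `F ^ n`, where `F` has `q` elements. -/
def Gr (F : Type*) [Field F] (k n : ℕ) : Set (Submodule F (Fin n → F)) :=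
  {U | Module.finrank F U = k}

/-- The subspace distance `dim U + dim V - 2 dim (U ∩ V)`. The subtraction is never truncated,
see `two_mul_finrank_inf_le`. -/
noncomputable def subspaceDist {F : Type*} [Field F] {n : ℕ}
    (U V : Submodule F (Fin n → F)) : ℕ :=
  Module.finrank F U + Module.finrank F V - 2 * Module.finrank F (U ⊓ V : Submodule F (Fin n → F))

theorem two_mul_finrank_inf_le {F : Type*} [Field F] {n : ℕ}
    (U V : Submodule F (Fin n → F)) :
    2 * Module.finrank F (U ⊓ V : Submodule F (Fin n → F)) ≤
      Module.finrank F U + Module.finrank F V := by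
  have h1 := Submodule.finrank_mono (inf_le_left : U ⊓ V ≤ U)
  have h2 := Submodule.finrank_mono (inf_le_right : U ⊓ V ≤ V)
  omega

/-- `C` is a subspace code of constant dimension `k` in `F ^ n`: a set of `k`-dimensional
subspaces with at least two elements. -/
def IsCode {F : Type*} [Field F] {n : ℕ} (k : ℕ) (C : Set (Submodule F (Fin n → F))) : Prop :=
  C ⊆ Gr F k n ∧ C.Nontrivial

/-- The minimum distance of a code. -/
noncomputable def minDist {F : Type*} [Field F] {n : ℕ}
    (C : Set (Submodule F (Fin n → F))) : ℕ :=
  sInf {d | ∃ U ∈ C, ∃ V ∈ C, U ≠ V ∧ d = subspaceDist U V}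

/-- Any two distinct codewords have distance equal to the minimum distance. -/
def IsEquidistant {F : Type*} [Field F] {n : ℕ} (C : Set (Submodule F (Fin n → F))) : Prop :=
  ∀ U ∈ C, ∀ V ∈ C, U ≠ V → subspaceDist U V = minDist C

/-- `C` is a `c`-intersecting equidistant code in `𝒢_q(k, n)` (used for `c < k`). -/
def IsIntersectingCode {F : Type*} [Field F] {n : ℕ} (k c : ℕ)
    (C : Set (Submodule F (Fin n → F))) : Prop :=
  IsCode k C ∧ IsEquidistant C ∧ minDist C = 2 * (k - c)

/-- `e_q(k, n, c)`, `q = |F|`: the largest cardinality of a `c`-intersecting equidistant code in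
`𝒢_q(k, n)`. It is a maximum as soon as such a code exists, see `isGreatest_maxCard`. -/
noncomputable def maxCard (F : Type*) [Field F] (k n c : ℕ) : ℕ :=
  sSup {m | ∃ C : Set (Submodule F (Fin n → F)), IsIntersectingCode k c C ∧ C.ncard = m}

theorem isGreatest_maxCard (F : Type*) [Field F] [Finite F] (k n c : ℕ)
    (h : ∃ C : Set (Submodule F (Fin n → F)), IsIntersectingCode k c C) :
    IsGreatest {m | ∃ C : Set (Submodule F (Fin n → F)), IsIntersectingCode k c C ∧ C.ncard = m}
      (maxCard F k n c) := by
  obtain ⟨C, hC⟩ := h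
  have hb : BddAbove
      {m | ∃ C : Set (Submodule F (Fin n → F)), IsIntersectingCode k c C ∧ C.ncard = m} :=
    ⟨Nat.card (Submodule F (Fin n → F)), by
      rintro m ⟨D, -, rfl⟩
      exact Set.ncard_le_card D⟩
  exact ⟨Nat.sSup_mem ⟨_, C, hC, rfl⟩ hb, fun m hm => le_csSup hb hm⟩

/-- `S` is a sunflower in `𝒢_q(k, n)`: a code any two distinct codewords of which intersect in
the same subspace, the center. -/
def IsSunflower {F : Type*} [Field F] {n : ℕ} (k : ℕ) (S : Set (Submodule F (Fin n → F))) : Prop :=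
  IsCode k S ∧ ∃ Z : Submodule F (Fin n → F), ∀ U ∈ S, ∀ V ∈ S, U ≠ V → U ⊓ V = Z

/-- The orthogonal of a subspace with respect to the standard inner product of `F ^ n`. -/
def orth {F : Type*} [Field F] {n : ℕ} (U : Submodule F (Fin n → F)) :
    Submodule F (Fin n → F) :=
  U.orthogonalBilin (dotProductBilin F F)

/-- The orthogonal code `{U^⊥ : U ∈ C}`. -/
def orthCode {F : Type*} [Field F] {n : ℕ} (C : Set (Submodule F (Fin n → F))) :
    Set (Submodule F (Fin n → F)) :=
  orth '' C

end SubspaceCode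

/-! Orthogonality turns the problem into one about `K = n - k` and `c' = n + c - 2k`, where `2n ≤ 3k
+ 1` becomes `3K ≤ n + 1`. There a sunflower of size `q ^ (n - K) ≥ q ^ (2K - 1)` exists: lift a
partial spread along a quotient map. So it suffices that every equidistant code this large is a
sunflower (`exists_center_of_large`); dividing an optimal code by its center then gives the equality
of maxima.

For that, a second moment estimate shows that each nonzero vector lies in at most `4 * q ^ (K - 1)`
codewords or in all but that many. Let `X` be the span of the vectors of the second kind. Most
codewords contain `X`, so `dim X ≤ c'`. If `dim X = c'`, a codeword missing `X` would bound the
number of those containing it by `q ^ K`, so `X` is the center. If `dim X < c'`, counting the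
incidences on one codeword gives a contradiction. -/

namespace SubspaceCode

/-! ### Large equidistant families are sunflowers -/

section Deza

open Finset Module
open scoped Classical

variable {F V : Type*} [Field F] [Finite F] [AddCommGroup V] [Module F V] [Fintype V]

omit [Finite F] in
theorem card_filter_mem_submodule (U : Submodule F V) :
    (univ.filter (· ∈ U)).card = Nat.card F ^ finrank F U := by
  have : Module.Finite F V := .of_finite
  rw [← Module.natCard_eq_pow_finrank]
  exact (Nat.subtype_card (p := (· ∈ U)) _ (by simp)).symm

-- Expanding the square gives `∑ a U * a W * |U ∩ W|`. Off the diagonal the intersection size is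
-- constant, so this part collapses to a multiple of `(∑ a U) ^ 2 = 0`.
omit [Finite F] in
theorem sum_sq_weighted_indicator {k c : ℕ} {C : Finset (Submodule F V)}
    (hk : ∀ U ∈ C, finrank F U = k)
    (hc : ∀ U ∈ C, ∀ W ∈ C, U ≠ W → finrank F (U ⊓ W : Submodule F V) = c)
    (a : Submodule F V → ℤ) (ha : ∑ U ∈ C, a U = 0) :
    ∑ y : V, (∑ U ∈ C, if y ∈ U then a U else 0) ^ 2 =
      ((Nat.card F : ℤ) ^ k - (Nat.card F : ℤ) ^ c) * ∑ U ∈ C, a U ^ 2 := by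
  have h1 : ∀ U ∈ C, ∀ W ∈ C,
      (∑ y : V, (if y ∈ U then a U else 0) * (if y ∈ W then a W else 0)) =
        (Nat.card F : ℤ) ^ c * (a U * a W) +
          if U = W then ((Nat.card F : ℤ) ^ k - (Nat.card F : ℤ) ^ c) * a U ^ 2 else 0 := by
    intro U hU W hW
    have h2 : ∀ y : V, (if y ∈ U then a U else 0) * (if y ∈ W then a W else 0) =
        if y ∈ U ⊓ W then a U * a W else 0 := by
      intro y
      by_cases h : y ∈ U <;> by_cases h' : y ∈ W <;> simp [h, h']
    simp_rw [h2]
    rw [← sum_filter, sum_const, card_filter_mem_submodule, nsmul_eq_mul]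
    by_cases h : U = W
    · subst h
      rw [inf_idem, hk U hU]
      simp
      ring
    · rw [hc U hU W hW h]
      simp [h]
  simp_rw [sq (∑ U ∈ C, _), sum_mul_sum]
  rw [sum_comm]
  simp_rw [sum_comm (s := (univ : Finset V))]
  rw [sum_congr rfl fun U hU => sum_congr rfl fun W hW => h1 U hU W hW]
  simp_rw [sum_add_distrib, ← mul_sum, ← sum_mul]
  rw [ha]
  simp [mul_sum]

/-- The degree dichotomy behind Deza's theorem on families with constant intersections. -/
theorem pred_card_mul_card_mul_card_le {k c : ℕ} {C : Finset (Submodule F V)}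
    (hk : ∀ U ∈ C, finrank F U = k)
    (hc : ∀ U ∈ C, ∀ W ∈ C, U ≠ W → finrank F (U ⊓ W : Submodule F V) = c)
    {x : V} (hx : x ≠ 0) (hd : (C.filter (x ∈ ·)).Nonempty) (he : (C.filter (x ∉ ·)).Nonempty) :
    ((Nat.card F : ℤ) - 1) * ((C.filter (x ∈ ·)).card * (C.filter (x ∉ ·)).card) ≤
      ((Nat.card F : ℤ) ^ k - (Nat.card F : ℤ) ^ c) *
        ((C.filter (x ∈ ·)).card + (C.filter (x ∉ ·)).card) := by
  have := Fintype.ofFinite F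
  set d : ℤ := ((C.filter (x ∈ ·)).card : ℤ) with hd_def
  set e : ℤ := ((C.filter (x ∉ ·)).card : ℤ) with he_def
  have hd0 : 0 < d := Nat.cast_pos.2 hd.card_pos
  have he0 : 0 < e := Nat.cast_pos.2 he.card_pos
  -- These weights sum to zero, and the weighted count equals `d * e` at each of the `q - 1` nonzero
  -- multiples of `x`.
  have key := sum_sq_weighted_indicator hk hc (fun U => if x ∈ U then e else -d) (by
    rw [sum_ite, sum_const, sum_const, nsmul_eq_mul, nsmul_eq_mul, ← hd_def, ← he_def]; ring)
  have h2 : ∑ U ∈ C, (if x ∈ U then e else -d) ^ 2 = d * e * (d + e) := by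
    simp_rw [ite_pow]
    rw [sum_ite, sum_const, sum_const, nsmul_eq_mul, nsmul_eq_mul, ← hd_def, ← he_def]; ring
  rw [h2] at key
  have h3 : ((Nat.card F : ℤ) - 1) * (d * e) ^ 2 ≤
      ∑ y : V, (∑ U ∈ C, if y ∈ U then (if x ∈ U then e else -d) else 0) ^ 2 := by
    have hinj : Function.Injective fun t : Fˣ => (t : F) • x := fun s t h =>
      Units.ext (smul_left_injective F hx h)
    calc ((Nat.card F : ℤ) - 1) * (d * e) ^ 2
        = ∑ y ∈ univ.image fun t : Fˣ => (t : F) • x, (d * e) ^ 2 := by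
          rw [sum_const, card_image_of_injective _ hinj, card_univ, Fintype.card_units,
            nsmul_eq_mul, Nat.cast_sub Fintype.card_pos, Nat.card_eq_fintype_card]
          simp
      _ = ∑ y ∈ univ.image fun t : Fˣ => (t : F) • x,
            (∑ U ∈ C, if y ∈ U then (if x ∈ U then e else -d) else 0) ^ 2 := by
          refine sum_congr rfl fun y hy => ?_
          obtain ⟨t, -, rfl⟩ := mem_image.1 hy
          have h4 : ∀ U : Submodule F V, (t : F) • x ∈ U ↔ x ∈ U := fun U =>
            U.smul_mem_iff t.ne_zero
          simp_rw [h4]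
          rw [← sum_filter, sum_congr rfl fun U hU => if_pos (mem_filter.1 hU).2, sum_const,
            nsmul_eq_mul]
      _ ≤ _ := sum_le_sum_of_subset_of_nonneg (subset_univ _) fun _ _ _ => sq_nonneg _
  rw [key] at h3
  have h5 : 0 < d * e := mul_pos hd0 he0
  refine le_of_mul_le_mul_left ?_ h5
  linarith

theorem card_filter_mem_le_or_card_filter_notMem_le {k c : ℕ} (hk0 : 0 < k)
    {C : Finset (Submodule F V)} (hk : ∀ U ∈ C, finrank F U = k)
    (hc : ∀ U ∈ C, ∀ W ∈ C, U ≠ W → finrank F (U ⊓ W : Submodule F V) = c)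
    {x : V} (hx : x ≠ 0) :
    (C.filter (x ∈ ·)).card ≤ 4 * Nat.card F ^ (k - 1) ∨
      (C.filter (x ∉ ·)).card ≤ 4 * Nat.card F ^ (k - 1) := by
  by_contra! h
  obtain ⟨h1, h2⟩ := h
  have h3 := pred_card_mul_card_mul_card_le hk hc hx (card_pos.1 (by omega)) (card_pos.1 (by omega))
  obtain ⟨j, rfl⟩ : ∃ j, k = j + 1 := ⟨k - 1, by omega⟩
  rw [Nat.add_sub_cancel] at h1 h2
  zify at h1 h2
  have hq : (2 : ℤ) ≤ Nat.card F := by exact_mod_cast (Finite.one_lt_card : 1 < Nat.card F)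
  generalize ((C.filter (x ∈ ·)).card : ℤ) = d at *
  generalize ((C.filter (x ∉ ·)).card : ℤ) = e at *
  generalize (Nat.card F : ℤ) = q at *
  have hqj : 0 < q ^ j := by positivity
  have hqc : 0 < q ^ c := by positivity
  have hd : 0 < d := by linarith
  have he : 0 < e := by linarith
  have h4 : (q ^ (j + 1) - q ^ c) * (d + e) ≤ q * (q ^ j * (d + e)) := by
    have : 0 < q ^ c * (d + e) := by positivity
    rw [pow_succ]; linarith
  -- Both degrees exceed `4 * q ^ j`; together with `q ≤ 2 * (q - 1)` this contradicts `h3`.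
  have h5 : 2 * (q ^ j * (d + e)) < d * e := by
    have := mul_lt_mul_of_pos_right h1 he
    have := mul_lt_mul_of_pos_right h2 hd
    linarith
  have h6 : q * (d * e) ≤ 2 * ((q - 1) * (d * e)) := by
    have : 0 ≤ (q - 2) * (d * e) := mul_nonneg (by linarith) (by positivity)
    linarith
  have h7 : q * (2 * (q ^ j * (d + e))) < q * (d * e) := mul_lt_mul_of_pos_left h5 (by linarith)
  linarith

omit [Finite F] in
/-- If not all members contain `X`, at most `q ^ k` of them do. -/
theorem card_filter_ge_le_of_exists_not_le {k c : ℕ} {C : Finset (Submodule F V)}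
    (hk : ∀ U ∈ C, finrank F U = k)
    (hc : ∀ U ∈ C, ∀ W ∈ C, U ≠ W → finrank F (U ⊓ W : Submodule F V) = c)
    {X : Submodule F V} (hX : finrank F X = c) {A : Submodule F V} (hA : A ∈ C) (hXA : ¬ X ≤ A) :
    (C.filter (X ≤ ·)).card ≤ Nat.card F ^ k := by
  have : Module.Finite F V := .of_finite
  -- `A ⊓ B` has the dimension of `X` but differs from it. Members containing `X` meet pairwise
  -- exactly in `X`, so the chosen vectors are distinct elements of `A`.
  have h1 : ∀ B ∈ C.filter (X ≤ ·), ∃ v, v ∈ A ∧ v ∈ B ∧ v ∉ X := by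
    intro B hB
    obtain ⟨hB, hXB⟩ := mem_filter.1 hB
    by_contra! h
    have h2 : A ⊓ B ≤ X := fun v hv => h v hv.1 hv.2
    have h3 := Submodule.eq_of_le_of_finrank_eq h2
      (by rw [hX, hc A hA B hB fun h => hXA (h ▸ hXB)])
    exact hXA (h3 ▸ inf_le_left)
  choose! f hfA hfB hfX using h1
  rw [← hk A hA, ← card_filter_mem_submodule]
  refine card_le_card_of_injOn f (fun B hB => by simpa using hfA B hB) fun B hB B' hB' h => ?_
  by_contra hne
  have hB1 := mem_filter.1 hB
  have hB1' := mem_filter.1 hB'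
  have h3 := Submodule.eq_of_le_of_finrank_eq (le_inf hB1.2 hB1'.2)
    (by rw [hX, hc B hB1.1 B' hB1'.1 hne])
  refine hfX B hB ?_
  rw [h3]
  exact ⟨hfB B hB, h ▸ hfB B' hB'⟩

omit [Finite F] in
theorem sum_card_filter_mem {k c : ℕ} {C : Finset (Submodule F V)}
    (hk : ∀ U ∈ C, finrank F U = k)
    (hc : ∀ U ∈ C, ∀ W ∈ C, U ≠ W → finrank F (U ⊓ W : Submodule F V) = c)
    {A : Submodule F V} (hA : A ∈ C) :
    ∑ x ∈ univ.filter (· ∈ A), (C.filter (x ∈ ·)).card =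
      (C.card - 1) * Nat.card F ^ c + Nat.card F ^ k := by
  have h1 : ∀ B ∈ C.erase A, ((univ.filter (· ∈ A)).filter (· ∈ B)).card = Nat.card F ^ c := by
    intro B hB
    rw [filter_filter, ← hc A hA B (mem_of_mem_erase hB) (ne_of_mem_erase hB).symm,
      ← card_filter_mem_submodule]
    simp only [Submodule.mem_inf]
  have h2 := sum_card_bipartiteAbove_eq_sum_card_bipartiteBelow
    (s := univ.filter (· ∈ A)) (t := C) (fun (x : V) (U : Submodule F V) => x ∈ U)
  simp only [bipartiteAbove, bipartiteBelow] at h2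
  rw [h2, ← sum_erase_add _ _ hA, sum_congr rfl h1, sum_const, card_erase_of_mem hA, smul_eq_mul,
    filter_filter]
  simp only [and_self]
  rw [card_filter_mem_submodule, hk A hA]

/-- A large equidistant code in dimension at least `3k - 1` is a sunflower. -/
theorem exists_center_of_large {k c : ℕ} (hck : c < k) {C : Finset (Submodule F V)}
    (hk : ∀ U ∈ C, finrank F U = k)
    (hc : ∀ U ∈ C, ∀ W ∈ C, U ≠ W → finrank F (U ⊓ W : Submodule F V) = c)
    (hq : 4 * finrank F V + 6 ≤ Nat.card F) (hC : Nat.card F ^ (2 * k - 1) ≤ C.card) :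
    ∃ Z : Submodule F V, ∀ U ∈ C, ∀ W ∈ C, U ≠ W → U ⊓ W = Z := by
  have : Module.Finite F V := .of_finite
  rcases Nat.eq_zero_or_pos c with rfl | hc0
  · exact ⟨⊥, fun U hU W hW h => Submodule.finrank_eq_zero.1 (hc U hU W hW h)⟩
  set q := Nat.card F with hq_def
  set D := 4 * q ^ (k - 1) with hD
  set T : Set V := {x | (C.filter (x ∉ ·)).card ≤ D} with hT
  obtain ⟨X, hX⟩ : ∃ X, X = Submodule.span F T := ⟨_, rfl⟩
  -- Spanning `X` by only `dim X` vectors of `T` lets a union bound control the codewords that miss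
  -- `X`.
  obtain ⟨f, hfT, hfspan⟩ : ∃ f : Fin (finrank F X) → V, (∀ i, f i ∈ T) ∧
      Submodule.span F (Set.range f) = X := by
    obtain ⟨f, hfT, hfspan, -⟩ := Submodule.exists_fun_fin_finrank_span_eq F T
    subst hX
    exact ⟨f, hfT, hfspan⟩
  have hXn : finrank F X ≤ finrank F V := Submodule.finrank_le X
  have hmiss : (C.filter (¬ X ≤ ·)).card ≤ finrank F V * D := by
    calc (C.filter (¬ X ≤ ·)).card
        ≤ ((univ : Finset (Fin (finrank F X))).biUnion fun i => C.filter (f i ∉ ·)).card := by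
          refine card_le_card fun U hU => ?_
          obtain ⟨hU, hXU⟩ := mem_filter.1 hU
          rw [← hfspan, Submodule.span_le, Set.range_subset_iff] at hXU
          push Not at hXU
          obtain ⟨i, hi⟩ := hXU
          exact mem_biUnion.2 ⟨i, mem_univ _, mem_filter.2 ⟨hU, hi⟩⟩
      _ ≤ ∑ i : Fin (finrank F X), D := card_biUnion_le.trans (sum_le_sum fun i _ => hfT i)
      _ = finrank F X * D := by simp
      _ ≤ _ := Nat.mul_le_mul_right _ hXn
  have hadd := card_filter_add_card_filter_not (s := C) (X ≤ ·)
  have hlarge : finrank F V * D + q ^ k + 1 < C.card := by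
    obtain ⟨j, rfl⟩ : ∃ j, k = j + 2 := ⟨k - 2, by omega⟩
    refine lt_of_lt_of_le ?_ hC
    have e1 : q ^ (2 * (j + 2) - 1) = q ^ (j + 1) * (q * (q * q ^ j)) := by
      rw [show 2 * (j + 2) - 1 = (j + 1) + (j + 2) by omega, pow_add, pow_succ q (j + 1),
        pow_succ q j]; ring
    have e2 : q ^ (j + 2) = q ^ (j + 1) * q := pow_succ _ _
    have h1 : 1 ≤ q ^ j := Nat.one_le_pow _ _ (by omega)
    have h2 : 1 ≤ q ^ (j + 1) := Nat.one_le_pow _ _ (by omega)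
    have h3 : q * q ≤ q * (q * q ^ j) := by nlinarith
    -- The lower bound on `q` is used here; `0 < c < k` forces `k ≥ 2`.
    have h4 : 4 * finrank F V + q + 2 ≤ q * q := by nlinarith
    rw [hD, e1, e2, show j + 2 - 1 = j + 1 by omega]
    have h5 := Nat.mul_le_mul_left (q ^ (j + 1)) (h4.trans h3)
    nlinarith
  obtain ⟨U, hU, W, hW, hUW⟩ := one_lt_card.1 (show 1 < (C.filter (X ≤ ·)).card by omega)
  have hXc : finrank F X ≤ c := by
    rw [mem_filter] at hU hW
    rw [← hc U hU.1 W hW.1 hUW]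
    exact Submodule.finrank_mono (le_inf hU.2 hW.2)
  rcases hXc.eq_or_lt with hXc | hXc
  · have hall : ∀ A ∈ C, X ≤ A := by
      intro A hA
      by_contra hXA
      have := card_filter_ge_le_of_exists_not_le hk hc hXc hA hXA
      rw [← hq_def] at this
      omega
    exact ⟨X, fun U hU W hW h => (Submodule.eq_of_le_of_finrank_eq
      (le_inf (hall U hU) (hall W hW)) (by rw [hXc, hc U hU W hW h])).symm⟩
  · exfalso
    have hA := (mem_filter.1 hU).1
    have h1 := sum_card_filter_mem hk hc hA
    -- Vectors in `X` number at most `q ^ (c - 1)`; every other vector of `U` has degree at most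
    -- `D`.
    have h2 : ∑ x ∈ univ.filter (· ∈ U), (C.filter (x ∈ ·)).card ≤
        q ^ (c - 1) * C.card + q ^ k * D := by
      rw [← sum_filter_add_sum_filter_not _ (· ∈ X)]
      refine add_le_add ?_ ?_
      · refine (sum_le_card_nsmul _ _ C.card fun x _ => card_filter_le _ _).trans ?_
        rw [smul_eq_mul]
        refine Nat.mul_le_mul_right _ ?_
        rw [filter_filter]
        calc _ ≤ (univ.filter (· ∈ X)).card := card_le_card fun x hx => by
                simp only [mem_filter] at hx ⊢; exact ⟨hx.1, hx.2.2⟩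
          _ = q ^ finrank F X := card_filter_mem_submodule X
          _ ≤ _ := Nat.pow_le_pow_right (by omega) (by omega)
      · refine (sum_le_card_nsmul _ _ D fun x hx => ?_).trans ?_
        · have hxX := (mem_filter.1 hx).2
          have hx0 : x ≠ 0 := fun h => hxX (h ▸ X.zero_mem)
          refine (card_filter_mem_le_or_card_filter_notMem_le (by omega) hk hc hx0).resolve_right
            fun h => hxX (hX ▸ Submodule.subset_span h)
        · rw [smul_eq_mul, ← hk U hA, ← card_filter_mem_submodule]
          exact Nat.mul_le_mul_right _ (card_filter_le _ _)
    rw [h1] at h2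
    obtain ⟨j, rfl⟩ : ∃ j, k = j + 1 := ⟨k - 1, by omega⟩
    obtain ⟨i, rfl⟩ : ∃ i, c = i + 1 := ⟨c - 1, by omega⟩
    obtain ⟨m, hm⟩ : ∃ m, C.card = m + 1 := ⟨C.card - 1, by omega⟩
    simp only [Nat.add_sub_cancel] at h2 hD
    rw [hm] at h2 hC
    rw [Nat.add_sub_cancel, ← hq_def] at h2
    -- Hence `q ^ k * D ≤ 4 * C.card`, the reason for the exponent `2k - 1`. It leaves `q ^ c ≤ q ^
    -- (c - 1) + 4`, impossible for `q ≥ 6`.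
    have e1 : q ^ (j + 1) * D = 4 * q ^ (2 * (j + 1) - 1) := by
      rw [hD, show 2 * (j + 1) - 1 = (j + 1) + j by omega, pow_add]; ring
    have h3 : q ^ (i + 1) ≤ q ^ (j + 1) := Nat.pow_le_pow_right (by omega) (by omega)
    have h4 : (m + 1) * q ^ (i + 1) ≤ q ^ i * (m + 1) + 4 * (m + 1) := by
      rw [add_mul, one_mul]
      rw [e1] at h2
      omega
    have h5 : 1 ≤ q ^ i := Nat.one_le_pow _ _ (by omega)
    have h6 : q ^ (i + 1) ≤ q ^ i + 4 := by
      refine le_of_mul_le_mul_left (a := m + 1) ?_ (by omega)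
      linarith
    have h7 : q ^ i * 6 ≤ q ^ i * q := Nat.mul_le_mul_left _ (by omega)
    rw [pow_succ] at h6
    omega

end Deza

/-! ### Sunflowers, partial spreads and optimal codes -/

section Codes

open Module

variable {F : Type*} [Field F] {n : ℕ}

theorem isIntersectingCode_iff {k c : ℕ} (hck : c ≤ k) {C : Set (Submodule F (Fin n → F))} :
    IsIntersectingCode k c C ↔ C.Nontrivial ∧ (∀ U ∈ C, finrank F U = k) ∧
      ∀ U ∈ C, ∀ W ∈ C, U ≠ W → finrank F (U ⊓ W : Submodule F (Fin n → F)) = c := by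
  constructor
  · rintro ⟨⟨hk, hC⟩, he, hd⟩
    refine ⟨hC, hk, fun U hU W hW h => ?_⟩
    have h1 := he U hU W hW h
    have h2 : finrank F (U ⊓ W : Submodule F (Fin n → F)) ≤ finrank F U :=
      Submodule.finrank_mono inf_le_left
    rw [hd, subspaceDist, show finrank F U = k from hk hU, show finrank F W = k from hk hW] at h1
    rw [show finrank F U = k from hk hU] at h2
    omega
  · rintro ⟨hC, hk, hc⟩
    have h1 : ∀ U ∈ C, ∀ W ∈ C, U ≠ W → subspaceDist U W = 2 * (k - c) := by
      intro U hU W hW h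
      rw [subspaceDist, hk U hU, hk W hW, hc U hU W hW h]
      omega
    have h2 : minDist C = 2 * (k - c) := by
      obtain ⟨U, hU, W, hW, hUW⟩ := hC
      rw [minDist, show {d | ∃ U ∈ C, ∃ V ∈ C, U ≠ V ∧ d = subspaceDist U V} = {2 * (k - c)} from ?_,
        csInf_singleton]
      ext d
      constructor
      · rintro ⟨U, hU, W, hW, h, rfl⟩
        exact h1 U hU W hW h
      · rintro rfl
        exact ⟨U, hU, W, hW, hUW, (h1 U hU W hW hUW).symm⟩
    exact ⟨⟨hk, hC⟩, fun U hU W hW h => (h1 U hU W hW h).trans h2.symm, h2⟩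

theorem ncard_le_maxCard [Finite F] {k c : ℕ} {C : Set (Submodule F (Fin n → F))}
    (hC : IsIntersectingCode k c C) : C.ncard ≤ maxCard F k n c :=
  (isGreatest_maxCard F k n c ⟨C, hC⟩).2 ⟨C, hC, rfl⟩

/-- Only optimal codes have to be transformed, so their sunflower structure can be used. -/
theorem maxCard_le_of_forall_exists [Finite F] {k c k' n' c' : ℕ}
    (hne : ∃ C : Set (Submodule F (Fin n → F)), IsIntersectingCode k c C)
    (h : ∀ C : Set (Submodule F (Fin n → F)), IsIntersectingCode k c C →
      C.ncard = maxCard F k n c →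
      ∃ D : Set (Submodule F (Fin n' → F)), IsIntersectingCode k' c' D ∧ D.ncard = C.ncard) :
    maxCard F k n c ≤ maxCard F k' n' c' := by
  obtain ⟨C, hC, hm⟩ := (isGreatest_maxCard F k n c hne).1
  obtain ⟨D, hD, hDC⟩ := h C hC hm
  rw [← hm, ← hDC]
  exact ncard_le_maxCard hD

theorem finrank_comap_of_surjective {V W : Type*} [AddCommGroup V] [Module F V]
    [AddCommGroup W] [Module F W] [FiniteDimensional F V] {f : V →ₗ[F] W}
    (hf : Function.Surjective f) (P : Submodule F W) :
    finrank F (P.comap f) = finrank F P + finrank F (LinearMap.ker f) := by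
  have h := LinearMap.finrank_range_add_finrank_ker (f.domRestrict (P.comap f))
  rw [LinearMap.range_domRestrict, Submodule.map_comap_eq_of_surjective hf,
    LinearMap.ker_domRestrict] at h
  rw [← h]
  congr 1
  exact (Submodule.comapSubtypeEquivOfLe
    (fun x hx => by simp [LinearMap.mem_ker.1 hx] : LinearMap.ker f ≤ P.comap f)).finrank_eq

theorem IsIntersectingCode.comap {a N c k : ℕ} {f : (Fin n → F) →ₗ[F] (Fin N → F)}
    (hf : Function.Surjective f) (hker : finrank F (LinearMap.ker f) = c) (hk : k = a + c)
    {C : Set (Submodule F (Fin N → F))} (hC : IsIntersectingCode a 0 C) :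
    IsIntersectingCode k c (Submodule.comap f '' C) ∧ (Submodule.comap f '' C).ncard = C.ncard := by
  subst hk
  have hinj := Submodule.comap_injective_of_surjective hf
  rw [isIntersectingCode_iff (Nat.zero_le _)] at hC
  rw [isIntersectingCode_iff (Nat.le_add_left _ _)]
  obtain ⟨hC, hk, hc⟩ := hC
  refine ⟨⟨hC.image hinj, ?_, ?_⟩, Set.ncard_image_of_injective _ hinj⟩
  · rintro _ ⟨U, hU, rfl⟩
    rw [finrank_comap_of_surjective hf, hk U hU, hker]
  · rintro _ ⟨U, hU, rfl⟩ _ ⟨W, hW, rfl⟩ h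
    rw [← Submodule.comap_inf, finrank_comap_of_surjective hf,
      hc U hU W hW (fun h' => h (by rw [h'])), hker, zero_add]

theorem IsIntersectingCode.map {a N c k : ℕ} {f : (Fin n → F) →ₗ[F] (Fin N → F)}
    (hf : Function.Surjective f) (hker : finrank F (LinearMap.ker f) = c) (hk : k = a + c)
    {C : Set (Submodule F (Fin n → F))} (hC : IsIntersectingCode k c C)
    (hker_le : ∀ U ∈ C, LinearMap.ker f ≤ U) :
    IsIntersectingCode a 0 (Submodule.map f '' C) ∧ (Submodule.map f '' C).ncard = C.ncard := by
  subst hk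
  rw [isIntersectingCode_iff (Nat.le_add_left _ _)] at hC
  rw [isIntersectingCode_iff (Nat.zero_le _)]
  obtain ⟨hC, hk, hc⟩ := hC
  have hcm : ∀ U ∈ C, (U.map f).comap f = U := fun U hU =>
    Submodule.comap_map_eq_self (hker_le U hU)
  have hinj : Set.InjOn (Submodule.map f) C := Set.LeftInvOn.injOn hcm
  refine ⟨⟨hC.image_of_injOn hinj, ?_, ?_⟩, hinj.ncard_image⟩
  · rintro _ ⟨U, hU, rfl⟩
    have := finrank_comap_of_surjective hf (U.map f)
    rw [hcm U hU, hk U hU, hker] at this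
    omega
  · rintro _ ⟨U, hU, rfl⟩ _ ⟨W, hW, rfl⟩ h
    have := finrank_comap_of_surjective hf (U.map f ⊓ W.map f)
    rw [Submodule.comap_inf, hcm U hU, hcm W hW, hker,
      hc U hU W hW (fun h' => h (by rw [h']))] at this
    omega

theorem exists_surjective_ker_eq {N : ℕ} (Z : Submodule F (Fin n → F))
    (hZ : finrank F Z + N = n) :
    ∃ f : (Fin n → F) →ₗ[F] (Fin N → F), Function.Surjective f ∧ LinearMap.ker f = Z := by
  have h := Submodule.finrank_quotient_add_finrank Z
  rw [finrank_fin_fun] at h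
  let e : ((Fin n → F) ⧸ Z) ≃ₗ[F] (Fin N → F) :=
    LinearEquiv.ofFinrankEq _ _ (by rw [finrank_fin_fun]; omega)
  refine ⟨e.toLinearMap ∘ₗ Z.mkQ, ?_, ?_⟩
  · exact e.surjective.comp Z.mkQ_surjective
  · rw [LinearEquiv.ker_comp, Submodule.ker_mkQ]

theorem exists_injective_of_le_finrank {V : Type*} [AddCommGroup V] [Module F V] {a : ℕ}
    (h : a ≤ finrank F V) : ∃ g : (Fin a → F) →ₗ[F] V, Function.Injective g := by
  obtain ⟨v, hv⟩ := exists_linearIndependent_of_le_finrank h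
  exact ⟨_, hv.fintypeLinearCombination_injective⟩

/-- Partial spreads from lines through the origin over an extension field. -/
theorem exists_partial_spread [Finite F] {a b N : ℕ} (ha : 0 < a) (hab : a ≤ b) (hN : N = a + b) :
    ∃ C : Set (Submodule F (Fin N → F)), IsIntersectingCode a 0 C ∧ C.ncard = Nat.card F ^ b := by
  obtain ⟨p, hp⟩ := CharP.exists F
  have : Fact p.Prime := ⟨CharP.char_is_prime F p⟩
  have : NeZero b := ⟨by omega⟩
  let K := FiniteField.Extension F p b
  have hK : finrank F K = b := FiniteField.finrank_extension F p b
  obtain ⟨g, hg⟩ : ∃ g : (Fin a → F) →ₗ[F] K, Function.Injective g :=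
    exists_injective_of_le_finrank (hab.trans_eq hK.symm)
  let e : ((Fin a → F) × K) ≃ₗ[F] (Fin N → F) :=
    LinearEquiv.ofFinrankEq _ _ (by
      rw [finrank_prod, finrank_fin_fun, finrank_fin_fun, hK, hN])
  -- The range is the line of slope `β` over the subspace `g (F ^ a)` of `K`; two slopes agree only
  -- at the origin.
  let L : K → (Fin a → F) →ₗ[F] (Fin N → F) := fun β =>
    e.toLinearMap ∘ₗ LinearMap.prod LinearMap.id (LinearMap.mulLeft F β ∘ₗ g)
  have hL : ∀ β x, L β x = e (x, β * g x) := fun β x => rfl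
  have hLinj : ∀ β, Function.Injective (L β) := fun β x y h => by
    simp only [hL, EmbeddingLike.apply_eq_iff_eq, Prod.mk.injEq] at h
    exact h.1
  have hfin : ∀ β, finrank F (LinearMap.range (L β)) = a := fun β => by
    rw [LinearMap.finrank_range_of_inj (hLinj β), finrank_fin_fun]
  have hdisj : ∀ β γ, β ≠ γ → LinearMap.range (L β) ⊓ LinearMap.range (L γ) = ⊥ := by
    intro β γ h
    rw [eq_bot_iff]
    rintro _ ⟨⟨x, rfl⟩, ⟨y, hy⟩⟩
    simp only [hL, EmbeddingLike.apply_eq_iff_eq, Prod.mk.injEq] at hy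
    obtain ⟨rfl, hy⟩ := hy
    have h1 : g y = 0 := by
      by_contra h0
      exact h (mul_right_cancel₀ h0 hy.symm)
    rw [map_eq_zero_iff g hg] at h1
    simp [h1]
  have hinj : Function.Injective fun β => LinearMap.range (L β) := by
    intro β γ h
    by_contra hne
    have h1 := hdisj β γ hne
    simp only at h
    rw [← h, inf_idem] at h1
    have h2 := hfin β
    rw [h1, finrank_bot] at h2
    omega
  refine ⟨Set.range fun β => LinearMap.range (L β), ?_, ?_⟩
  · rw [isIntersectingCode_iff (Nat.zero_le _)]
    refine ⟨⟨_, ⟨0, rfl⟩, _, ⟨1, rfl⟩, fun h => zero_ne_one (hinj h)⟩, ?_, ?_⟩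
    · rintro _ ⟨β, rfl⟩
      exact hfin β
    · rintro _ ⟨β, rfl⟩ _ ⟨γ, rfl⟩ h
      rw [hdisj β γ (fun h' => h (by rw [h'])), finrank_bot]
  · rw [← Set.image_univ, Set.ncard_image_of_injective _ hinj, Set.ncard_univ,
      ← FiniteField.natCard_extension F p b]

theorem exists_center_of_pow_le_ncard [Finite F] {k c : ℕ} (hck : c < k) (hn : 3 * k ≤ n + 1)
    (hq : 4 * n + 6 ≤ Nat.card F) {C : Set (Submodule F (Fin n → F))}
    (hC : IsIntersectingCode k c C) (hcard : Nat.card F ^ (n - k) ≤ C.ncard) :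
    ∃ Z : Submodule F (Fin n → F), ∀ U ∈ C, ∀ W ∈ C, U ≠ W → U ⊓ W = Z := by
  have := Fintype.ofFinite F
  have := Fintype.ofFinite (Fin n → F)
  have hfin : C.Finite := C.toFinite
  obtain ⟨-, hk, hc⟩ := (isIntersectingCode_iff hck.le).1 hC
  have h := exists_center_of_large (C := hfin.toFinset) hck
    (by simpa using hk) (by simpa using hc) (by rwa [finrank_fin_fun])
    (by
      rw [← Set.ncard_eq_toFinset_card C hfin]
      -- `3k ≤ n + 1` says exactly that `2k - 1 ≤ n - k`.
      exact (Nat.pow_le_pow_right Nat.card_pos (by omega)).trans hcard)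
  simpa using h

/-- In dimension at least `3k - 1` over a large field, optimal equidistant codes are sunflowers. -/
theorem maxCard_eq_and_isSunflower [Finite F] {k c : ℕ} (hck : c < k) (hn : 3 * k ≤ n + 1)
    (h2k : 2 * k ≤ n + c) (hq : 4 * n + 6 ≤ Nat.card F) :
    (∃ C : Set (Submodule F (Fin n → F)), IsIntersectingCode k c C) ∧
    maxCard F k n c = maxCard F (k - c) (n - c) 0 ∧
      ∀ C : Set (Submodule F (Fin n → F)), IsIntersectingCode k c C →
        C.ncard = maxCard F k n c → IsSunflower k C := by
  have hk : k = (k - c) + c := by omega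
  obtain ⟨P, hP, hPcard⟩ := exists_partial_spread (F := F) (a := k - c) (b := n - k) (N := n - c)
    (by omega) (by omega) (by omega)
  obtain ⟨Z, hZ⟩ : ∃ Z : Submodule F (Fin n → F), finrank F Z = c := by
    obtain ⟨g, hg⟩ : ∃ g : (Fin c → F) →ₗ[F] (Fin n → F), Function.Injective g :=
      exists_injective_of_le_finrank (by rw [finrank_fin_fun]; omega)
    exact ⟨LinearMap.range g, by rw [LinearMap.finrank_range_of_inj hg, finrank_fin_fun]⟩
  obtain ⟨f, hf, hfZ⟩ := exists_surjective_ker_eq (N := n - c) Z (by omega)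
  have hle : maxCard F (k - c) (n - c) 0 ≤ maxCard F k n c :=
    maxCard_le_of_forall_exists ⟨P, hP⟩ fun C hC _ => ⟨_, hC.comap hf (by rw [hfZ, hZ]) hk⟩
  have hlow : Nat.card F ^ (n - k) ≤ maxCard F k n c :=
    (hPcard ▸ ncard_le_maxCard hP).trans hle
  have hne : ∃ C : Set (Submodule F (Fin n → F)), IsIntersectingCode k c C :=
    ⟨_, (hP.comap hf (by rw [hfZ, hZ]) hk).1⟩
  refine ⟨hne, le_antisymm (maxCard_le_of_forall_exists hne fun C hC hm => ?_) hle,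
    fun C hC hm => ⟨hC.1, exists_center_of_pow_le_ncard hck hn hq hC (hm ▸ hlow)⟩⟩
  obtain ⟨X, hX⟩ := exists_center_of_pow_le_ncard hck hn hq hC (hm ▸ hlow)
  obtain ⟨hnt, -, hc⟩ := (isIntersectingCode_iff hck.le).1 hC
  have hXc : finrank F X = c := by
    obtain ⟨U, hU, W, hW, h⟩ := hnt
    rw [← hX U hU W hW h, hc U hU W hW h]
  obtain ⟨f, hf, hfX⟩ := exists_surjective_ker_eq (N := n - c) X (by omega)
  refine ⟨_, hC.map hf (by rw [hfX, hXc]) hk fun U hU => ?_⟩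
  obtain ⟨W, hW, h⟩ := hnt.exists_ne U
  rw [hfX, ← hX U hU W hW h.symm]
  exact inf_le_left

end Codes

/-! ### Orthogonal codes -/

section Orthogonal

open Module

variable {F : Type*} [Field F] {n : ℕ}

theorem nondegenerate_dotProductBilin :
    (dotProductBilin F F : LinearMap.BilinForm F (Fin n → F)).Nondegenerate := by
  constructor
  · intro x hx
    exact dotProduct_eq_zero_iff.1 hx
  · intro x hx
    exact dotProduct_eq_zero_iff.1 fun y => by rw [dotProduct_comm]; exact hx y

theorem isRefl_dotProductBilin :
    LinearMap.BilinForm.IsRefl (dotProductBilin F F : LinearMap.BilinForm F (Fin n → F)) := fun x y h => by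
  rw [← h]
  exact dotProduct_comm y x

theorem finrank_orth (U : Submodule F (Fin n → F)) :
    finrank F (orth U) = n - finrank F U := by
  have h := LinearMap.BilinForm.finrank_orthogonal nondegenerate_dotProductBilin U
  rwa [finrank_fin_fun] at h

theorem orth_orth (U : Submodule F (Fin n → F)) : orth (orth U) = U :=
  LinearMap.BilinForm.orthogonal_orthogonal nondegenerate_dotProductBilin isRefl_dotProductBilin U

theorem orth_inf_orth (U W : Submodule F (Fin n → F)) : orth U ⊓ orth W = orth (U ⊔ W) := by
  refine le_antisymm ?_ (le_inf (Submodule.orthogonalBilin_le le_sup_left)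
    (Submodule.orthogonalBilin_le le_sup_right))
  rintro x ⟨hU, hW⟩ y hy
  obtain ⟨u, hu, w, hw, rfl⟩ := Submodule.mem_sup.1 hy
  rw [map_add, LinearMap.add_apply, hU u hu, hW w hw, add_zero]

theorem injective_orth : Function.Injective (orth : Submodule F (Fin n → F) → _) :=
  Function.LeftInverse.injective orth_orth

theorem orthCode_orthCode (C : Set (Submodule F (Fin n → F))) : orthCode (orthCode C) = C := by
  simp [orthCode, Set.image_image, orth_orth]

theorem ncard_orthCode (C : Set (Submodule F (Fin n → F))) : (orthCode C).ncard = C.ncard :=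
  Set.ncard_image_of_injective _ injective_orth

/-- `U^⊥ ∩ W^⊥ = (U + W)^⊥`, and `U + W` has dimension `2k - c`. -/
theorem IsIntersectingCode.orthCode {k c k' c' : ℕ} (hck : c ≤ k) (hk : k' + k = n)
    (hc' : c' + 2 * k = n + c) {C : Set (Submodule F (Fin n → F))}
    (hC : IsIntersectingCode k c C) : IsIntersectingCode k' c' (orthCode C) := by
  rw [isIntersectingCode_iff hck] at hC
  rw [isIntersectingCode_iff (by omega)]
  obtain ⟨hnt, hd, hc⟩ := hC
  refine ⟨hnt.image injective_orth, ?_, ?_⟩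
  · rintro _ ⟨U, hU, rfl⟩
    rw [finrank_orth, hd U hU]
    omega
  · rintro _ ⟨U, hU, rfl⟩ _ ⟨W, hW, rfl⟩ h
    have h1 := Submodule.finrank_sup_add_finrank_inf_eq U W
    rw [hc U hU W hW (fun h' => h (by rw [h'])), hd U hU, hd W hW] at h1
    rw [orth_inf_orth, finrank_orth]
    omega

end Orthogonal

end SubspaceCode

theorem mainTheorem5 (k n c : ℕ) (hk : 1 ≤ k) (hkn : k < n) (hc : c < k)
    (hcode : 2 * k ≤ n + c) (hn : 2 * n ≤ 3 * k + 1) :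
    ∃ q₀ : ℕ, ∀ (F : Type*) [Field F] [Finite F], q₀ ≤ Nat.card F →
      SubspaceCode.maxCard F k n c = SubspaceCode.maxCard F (k - c) (2 * k - c) 0 ∧
      ∀ C : Set (Submodule F (Fin n → F)), SubspaceCode.IsIntersectingCode k c C →
        C.ncard = SubspaceCode.maxCard F k n c →
        ∃ S : Set (Submodule F (Fin n → F)),
          SubspaceCode.IsSunflower (n - k) S ∧ C = SubspaceCode.orthCode S := by
  refine ⟨4 * n + 6, fun F _ _ hq => ?_⟩
  -- The parameters of the orthogonal code; its partial spread condition `2 * (n - k) ≤ n + (n + c -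
  -- 2 * k)` reduces to `0 ≤ c`.
  obtain ⟨⟨D, hD⟩, hmax, hsun⟩ := SubspaceCode.maxCard_eq_and_isSunflower (F := F) (n := n)
    (k := n - k) (c := n + c - 2 * k) (by omega) (by omega) (by omega) hq
  rw [show n - k - (n + c - 2 * k) = k - c by omega,
    show n - (n + c - 2 * k) = 2 * k - c by omega] at hmax
  have horth : ∀ C : Set (Submodule F (Fin n → F)), SubspaceCode.IsIntersectingCode k c C →
      SubspaceCode.IsIntersectingCode (n - k) (n + c - 2 * k) (SubspaceCode.orthCode C) :=
    fun C hC => hC.orthCode hc.le (by omega) (by omega)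
  have horth' : ∀ C : Set (Submodule F (Fin n → F)),
      SubspaceCode.IsIntersectingCode (n - k) (n + c - 2 * k) C →
      SubspaceCode.IsIntersectingCode k c (SubspaceCode.orthCode C) :=
    fun C hC => hC.orthCode (by omega) (by omega) (by omega)
  have heq : SubspaceCode.maxCard F k n c =
      SubspaceCode.maxCard F (n - k) n (n + c - 2 * k) :=
    le_antisymm
      (SubspaceCode.maxCard_le_of_forall_exists ⟨_, horth' D hD⟩ fun C hC _ =>
        ⟨_, horth C hC, SubspaceCode.ncard_orthCode C⟩)
      (SubspaceCode.maxCard_le_of_forall_exists ⟨D, hD⟩ fun C hC _ =>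
        ⟨_, horth' C hC, SubspaceCode.ncard_orthCode C⟩)
  refine ⟨heq.trans hmax, fun C hC hm => ⟨SubspaceCode.orthCode C, hsun _ (horth C hC) ?_,
    (SubspaceCode.orthCode_orthCode C).symm⟩⟩
  rw [SubspaceCode.ncard_orthCode, hm, heq]
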